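/- **Theorem (asymptotic universal focal decomposition).** Let $\mathbb R_0^+=[0,\infty)$ and $\mathcal C=\mathbb R_0^+\times[-1,1]$. Let $\mathfrak P$ be the class of triples $(m,\mathcal V,q^*)$ where $m>0$, $q^*\in\mathbb R$ and $\mathcal V:\mathbb R\to\mathbb R$ is a $C^5$ potential whose Taylor expansion at $q^*$ is $$\mathcal V(q)=\mathcal V(q^*)+\tfrac{\mathcal V''(q^*)}{2}(q-q^*)^2+\tfrac{\mathcal V^{(4)}(q^*)}{4!}(q-q^*)^4+O(|q-q^*|^5),\qquad \mathcal V''(q^*)>0,\quad \mathcal V^{(4)}(q^*)\neq0 .$$ For such a triple let $\ell=\pm1$ be the sign of $\mathcal V^{(4)}(q^*)$, let $\omega=(\mathcal V''(q^*)/m)^{1/2}$ and $\mu=(3!\,\mathcal V''(q^*)/|\mathcal V^{(4)}(q^*)|)^{1/2}$, and let $q(\nu;\tau)$ denote the solution of the Euler–Lagrange equation $m\,\frac{d^2q}{d\tau^2}=-\mathcal V'(q)$ with $q(\nu;0)=q^*$ and $\frac{dq}{d\tau}(\nu;0)=\nu$. For $n\ge1$ put $\Gamma_{n,t}=\left(\frac{8t}{3\pi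 n}\right)^{1/2}$ and define the renormalized trajectories $$x_n(v;t)=(-1)^n\,\Gamma_{n,t}^{-1}\mu^{-1}\left[q\!\left(\Gamma_{n,t}\,\mu\,\omega\, v;\tfrac{n\pi-\ell t}{\omega}\right)-q^*\right]\quad(t>0),\qquad x_n(v;0)=0,$$ and the asymptotic trajectories $X_\ell(v;t)=v\sin\left(\ell t(v^2-1)\right)$. There is a family of sets $(\sigma_i)_{i\in\{0,1,2,\dots,\infty\}}$, the same for all triples in $\mathfrak P$, which are pairwise disjoint and have union $\mathcal C$, such that the following holds for every $(m,\mathcal V,q^*)\in\mathfrak P$: 1. For every $i\in\{0,1,2,\dots,\infty\}$, $\sigma_i$ is the set of all $(t,x)\in\mathcal C$ for which the equation $X_\ell(v;t)=x$ has exactly $i$ solutions $v\in[-1,1]$. 2. There is $\epsilon>0$ such that for all $\nu\in[-\epsilon,\epsilon]$ the solution $q(\nu;\cdot)$ exists on all of $\mathbb R$, is unique, and is periodic. 3. Let $\epsilon>0$ be such that $q(\nu;\cdot)$ is defined on $\mathbb R$ for all $\nu\in[-\epsilon,\epsilon]$. Then there are $\alpha>0$ and $N\ge1$ such that $\Gamma_{n,t}\mu\omega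 v\in[-\epsilon,\epsilon]$ for all $n\ge N$ and $(v,t)\in[-1,1]\times[0,\alpha n]$, so that $x_n$ is well defined on $[-1,1]\times[0,\alpha n]$. Moreover there is $\beta>0$ such that for every $0<\delta<1/3$ there are $C>0$ and $N'\ge N$ such that, for all $n\ge N'$, $\beta n^{1/3-\delta}\le\alpha n$ and $$\sup_{(v,t)\in[-1,1]\times[0,\beta n^{1/3-\delta}]}\left|x_n(v;t)-X_\ell(v;t)\right|\le C\,n^{-3\delta/2}.$$ -/

import Mathlib

noncomputable section

open Set

/-- The class of potentials: `V` is of class `C⁵`, and its Taylor expansion at `qs` is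
`V qs + V''(qs)/2 (q - qs)² + V⁗(qs)/4! (q - qs)⁴ + O(|q - qs|⁵)` (no linear and no cubic term)
with `V''(qs) > 0` and `V⁗(qs) ≠ 0`. The last condition makes `V` non-isochronous. -/
structure IsNonIsochronousAt (V : ℝ → ℝ) (qs : ℝ) : Prop where
  contDiff : ContDiff ℝ 5 V
  deriv_eq_zero : deriv V qs = 0
  deriv_two_pos : 0 < iteratedDeriv 2 V qs
  deriv_three_eq_zero : iteratedDeriv 3 V qs = 0
  deriv_four_ne_zero : iteratedDeriv 4 V qs ≠ 0

/-- `y` is a solution, defined for all times, of the Euler–Lagrange equation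
`m y'' = -V'(y)` with `y(0) = qs` and `y'(0) = ν`. -/
structure IsELSolution (m : ℝ) (V : ℝ → ℝ) (qs ν : ℝ) (y : ℝ → ℝ) : Prop where
  differentiable : Differentiable ℝ y
  differentiable_deriv : Differentiable ℝ (deriv y)
  eulerLagrange : ∀ τ, m * deriv (deriv y) τ = -deriv V (y τ)
  init_pos : y 0 = qs
  init_vel : deriv y 0 = ν

/-- `ℓ = ±1`, the sign of the fourth derivative of the potential at the equilibrium. -/
def ellSign (V : ℝ → ℝ) (qs : ℝ) : ℝ := Real.sign (iteratedDeriv 4 V qs)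

/-- The natural frequency `ω = (V''(qs) / m)^{1/2}`. -/
def omegaScale (m : ℝ) (V : ℝ → ℝ) (qs : ℝ) : ℝ := √(iteratedDeriv 2 V qs / m)

/-- The natural length `μ = (3! V''(qs) / |V⁗(qs)|)^{1/2}`. -/
def muScale (V : ℝ → ℝ) (qs : ℝ) : ℝ :=
  √(6 * iteratedDeriv 2 V qs / |iteratedDeriv 4 V qs|)

/-- The scaling parameter `Γ_{n,t} = (8 t / (3 π n))^{1/2}`. -/
def scalingParam (n : ℕ) (t : ℝ) : ℝ := √(8 * t / (3 * Real.pi * n))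

/-- The `n`-renormalized trajectory
`x_n(v;t) = (-1)ⁿ Γ⁻¹ μ⁻¹ [q(Γ μ ω v; (n π - ℓ t) / ω) - qs]` with `Γ = Γ_{n,t}`.
At `t = 0` one has `Γ = 0`, and the value here is `0`, which is also the limit as `t ↓ 0`. -/
def renormTrajectory (m : ℝ) (V : ℝ → ℝ) (qs : ℝ) (q : ℝ → ℝ → ℝ) (n : ℕ) (v t : ℝ) : ℝ :=
  (-1) ^ n * (scalingParam n t)⁻¹ * (muScale V qs)⁻¹ *
    (q (scalingParam n t * muScale V qs * omegaScale m V qs * v)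
      ((n * Real.pi - ellSign V qs * t) / omegaScale m V qs) - qs)

/-- The asymptotic trajectories `X_ℓ(v;t) = v sin(ℓ t (v² - 1))`. -/
def asymptoticTrajectory (l v t : ℝ) : ℝ := v * Real.sin (l * t * (v ^ 2 - 1))

/-- The half-cylinder `ℝ₀⁺ × [-1,1]` of points `(t,x)`. -/
def halfCylinder : Set (ℝ × ℝ) := Ici 0 ×ˢ Icc (-1) 1

/-- The set `σ_i`, `i ∈ {0,1,...,∞}`, of the points `(t,x)` of the half-cylinder for which
`X_ℓ(v;t) = x` has exactly `i` solutions `v ∈ [-1,1]`. -/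
def asymptoticFocalSet (l : ℝ) (i : ℕ∞) : Set (ℝ × ℝ) :=
  {p | p ∈ halfCylinder ∧ {v : ℝ | v ∈ Icc (-1) 1 ∧ asymptoticTrajectory l v p.1 = p.2}.encard = i}

end

/-! In the length unit `muScale` and the time unit `1 / omegaScale`, every system of the class
becomes `u'' = -g u` with `g u = u + l u³ + O(u⁴)`: up to the remainder only the sign `l` survives
(`exists_isDuffingForce`). Energy conservation traps small orbits where `g` is controlled, whence
global existence and uniqueness.

For `z = u' + i u`, a near-identity cubic change of variables removes all cubic terms except the
resonant `(3/8) i l |z|² z`. Since `|z|²` is conserved up to `O(a⁴)`, an orbit of amplitude `a` is a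
rotation of frequency `1 + 3 l a² / 8`, with error `O(|a|³ + a⁴ |s|)` (`norm_sub_rotation_le`). This
estimate gives two turning points, and time reversal about both of them gives periodicity
(`periodic`).

Put `a = Γ v` and `s = n π - l t`. The choice of `Γ` makes the frequency shift accumulated over `n
π` equal to `l t v²`, so the phase is `n π + l t (v² - 1)` up to `O(Γ² t)`. Division by `Γ` leaves
an error `O(Γ² + Γ² t + Γ³ (n + t))`. For `t ≲ n^(1/3 - δ)` the worst term is `Γ³ n ≲ n^(-3δ/2)`,
which fixes the rate (`renormTrajectory_sub_le`).

The sets `σ_i` do not depend on the system because `v ↦ -v` exchanges the two signs of `l`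
(`asymptoticFocalSet_neg_one`). -/

section

open Set

/-! ### Energy conservation and trapping of small orbits -/

/-- A restoring force `g` with potential `G` on `[-ρ, ρ]`, `ρ ≤ 1`, of the form
`g u = u + l u³ + O(u⁴)` with `l = ±1`. -/
structure IsDuffingForce (g G : ℝ → ℝ) (l ρ K : ℝ) (L : NNReal) : Prop where
  pos : 0 < ρ
  le_one : ρ ≤ 1
  nonneg : 0 ≤ K
  abs_sign : |l| = 1
  hasDerivAt : ∀ u, HasDerivAt G (g u) u
  zero : G 0 = 0
  lipschitz : LipschitzOnWith L g (Icc (-ρ) ρ)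
  near_linear : ∀ u, |u| ≤ ρ → |g u - u| ≤ |u| / 4
  near_cubic : ∀ u, |u| ≤ ρ → |g u - u - l * u ^ 3| ≤ K * |u| ^ 4

/-- `(y, p)` solves `y' = k p`, `p' = -h y` with initial data `(0, a)`. -/
structure IsHamiltonianCurve (k h : ℝ → ℝ) (a : ℝ) (y p : ℝ → ℝ) : Prop where
  deriv_pos : ∀ s, HasDerivAt y (k (p s)) s
  deriv_vel : ∀ s, HasDerivAt p (-h (y s)) s
  init_pos : y 0 = 0
  init_vel : p 0 = a

/-- If `|f'| ≤ M |u|ᵏ` near `0` and `f 0 = 0`, then `|f| ≤ M |u|ᵏ⁺¹` near `0`. -/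
lemma abs_le_mul_pow_succ_of_abs_deriv_le {f f' : ℝ → ℝ} {ρ M : ℝ} {k : ℕ} (hM : 0 ≤ M)
    (hf : ∀ u, |u| ≤ ρ → HasDerivAt f (f' u) u) (h0 : f 0 = 0)
    (hb : ∀ u, |u| ≤ ρ → |f' u| ≤ M * |u| ^ k) (u : ℝ) (hu : |u| ≤ ρ) :
    |f u| ≤ M * |u| ^ (k + 1) := by
  have h : ‖f u - f 0‖ ≤ M * |u| ^ k * ‖u - 0‖ := by
    refine Convex.norm_image_sub_le_of_norm_hasDerivWithin_le (s := Icc (-|u|) |u|)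
      (f' := f') (fun x hx => ?_) (fun x hx => ?_) (convex_Icc _ _) ?_ ?_
    · exact (hf x ((abs_le.2 hx).trans hu)).hasDerivWithinAt
    · have hx' := abs_le.2 hx
      refine (hb x (hx'.trans hu)).trans ?_
      gcongr
    · exact ⟨by simp, abs_nonneg u⟩
    · exact abs_le.1 le_rfl
  rw [h0, sub_zero, sub_zero, Real.norm_eq_abs, Real.norm_eq_abs] at h
  rw [pow_succ, ← mul_assoc]
  exact h

lemma abs_potential_sub_le {h H : ℝ → ℝ} {ρ : ℝ} (hH : ∀ u, HasDerivAt H (h u) u) (H0 : H 0 = 0)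
    (hlin : ∀ u, |u| ≤ ρ → |h u - u| ≤ |u| / 4) (u : ℝ) (hu : |u| ≤ ρ) :
    |H u - u ^ 2 / 2| ≤ u ^ 2 / 4 := by
  have := abs_le_mul_pow_succ_of_abs_deriv_le (f := fun u => H u - u ^ 2 / 2)
    (f' := fun u => h u - u) (M := 1 / 4) (k := 1) (ρ := ρ) (by norm_num)
    (fun u _ => by
      have h2 := (hH u).sub (((hasDerivAt_id u).pow 2).div_const 2)
      refine h2.congr_deriv ?_
      simp) (by simp [H0])
    (fun u hu => by have := hlin u hu; linarith [pow_one |u|]) u hu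
  rw [sq_abs] at this
  linarith

namespace IsHamiltonianCurve

variable {k h K H : ℝ → ℝ} {a : ℝ} {y p : ℝ → ℝ}

lemma energy (hc : IsHamiltonianCurve k h a y p) (hK : ∀ u, HasDerivAt K (k u) u)
    (hH : ∀ u, HasDerivAt H (h u) u) (s : ℝ) : K (p s) + H (y s) = K a + H 0 := by
  have hd : ∀ s, HasDerivAt (fun s => K (p s) + H (y s)) 0 s := fun s => by
    refine (((hK (p s)).comp s (hc.deriv_vel s)).add
      ((hH (y s)).comp s (hc.deriv_pos s))).congr_deriv ?_
    ring
  have := is_const_of_deriv_eq_zero (fun s => (hd s).differentiableAt) (fun s => (hd s).deriv) s 0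
  simpa [hc.init_pos, hc.init_vel] using this

/-- Orbits starting close to a nondegenerate minimum of the energy stay close to it. -/
lemma sq_add_sq_le {ρ : ℝ} (hc : IsHamiltonianCurve k h a y p) (hρ : 0 < ρ)
    (hK : ∀ u, HasDerivAt K (k u) u) (hH : ∀ u, HasDerivAt H (h u) u) (K0 : K 0 = 0)
    (H0 : H 0 = 0) (hk : ∀ u, |u| ≤ ρ → |k u - u| ≤ |u| / 4)
    (hh : ∀ u, |u| ≤ ρ → |h u - u| ≤ |u| / 4) (ha : 3 * a ^ 2 < ρ ^ 2) (s : ℝ) :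
    y s ^ 2 + p s ^ 2 ≤ 3 * a ^ 2 := by
  -- Inside the disc of radius `ρ` each potential lies between a quarter and three quarters of the
  -- square of its argument, so `(y² + p²) / 4 ≤ 3 a² / 4`.
  have key : ∀ s, y s ^ 2 + p s ^ 2 ≤ ρ ^ 2 → y s ^ 2 + p s ^ 2 ≤ 3 * a ^ 2 := fun s hs => by
    have hy : |y s| ≤ ρ := abs_le_of_sq_le_sq (by nlinarith) hρ.le
    have hp : |p s| ≤ ρ := abs_le_of_sq_le_sq (by nlinarith) hρ.le
    have ha' : |a| ≤ ρ := abs_le_of_sq_le_sq (by nlinarith) hρ.le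
    have h1 := abs_le.1 (abs_potential_sub_le hH H0 hh _ hy)
    have h2 := abs_le.1 (abs_potential_sub_le hK K0 hk _ hp)
    have h3 := abs_le.1 (abs_potential_sub_le hK K0 hk _ ha')
    have h4 := hc.energy hK hH s
    linarith
  by_contra! hlt
  have hcont : Continuous fun s => y s ^ 2 + p s ^ 2 := by
    have h1 : Continuous y := continuous_iff_continuousAt.2 fun s => (hc.deriv_pos s).continuousAt
    have h2 : Continuous p := continuous_iff_continuousAt.2 fun s => (hc.deriv_vel s).continuousAt
    fun_prop
  have h0 : y 0 ^ 2 + p 0 ^ 2 = a ^ 2 := by rw [hc.init_pos, hc.init_vel]; ring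
  -- An orbit leaving the small disc would, by continuity, take a value in `(3 a², ρ²]`, which `key`
  -- forbids.
  obtain ⟨r, hr⟩ := mem_range_of_exists_le_of_exists_ge
    (c := min (y s ^ 2 + p s ^ 2) (ρ ^ 2)) hcont
    ⟨0, by rw [h0]; exact le_min (by nlinarith) (by nlinarith)⟩ ⟨s, min_le_left _ _⟩
  have hr' : y r ^ 2 + p r ^ 2 = min (y s ^ 2 + p s ^ 2) (ρ ^ 2) := hr
  have h5 := key r (hr' ▸ min_le_right _ _)
  rw [hr'] at h5
  exact absurd (lt_min hlt ha) (not_lt.2 h5)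

end IsHamiltonianCurve

/-! ### Global existence and uniqueness -/

/-- A bounded, globally Lipschitz autonomous vector field has global integral curves. -/
lemma exists_hasDerivAt_of_lipschitz_of_bounded {E : Type*} [NormedAddCommGroup E]
    [NormedSpace ℝ E] [CompleteSpace E] {f : E → E} {K M : NNReal} (hf : LipschitzWith K f)
    (hM : ∀ x, ‖f x‖ ≤ M) (x₀ : E) : ∃ γ : ℝ → E, γ 0 = x₀ ∧ ∀ s, HasDerivAt γ (f (γ s)) s := by
  have hloc : ∀ n : ℕ, ∃ γ : ℝ → E, γ 0 = x₀ ∧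
      ∀ s ∈ Ioo (-((n : ℝ) + 1)) (n + 1), HasDerivAt γ (f (γ s)) s := fun n => by
    have hn : (0 : ℝ) ≤ n + 1 := by positivity
    -- Speed at most `M` confines a solution to a ball of radius `M (n + 1)`, so Picard–Lindelöf
    -- applies on the whole interval. The extra `1` makes every `|s| ≤ n` an interior point.
    have hP : IsPicardLindelof (fun _ => f) (tmin := -((n : ℝ) + 1)) (tmax := n + 1)
        ⟨0, by constructor <;> linarith⟩ x₀ (M * (n + 1)) 0 M K := by
      refine IsPicardLindelof.of_time_independent (fun x _ => hM x) hf.lipschitzOnWith ?_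
      simp
    obtain ⟨γ, h0, hγ⟩ := hP.exists_eq_forall_mem_Icc_hasDerivWithinAt₀
    exact ⟨γ, h0, fun s hs => (hγ s (Ioo_subset_Icc_self hs)).hasDerivAt (Icc_mem_nhds hs.1 hs.2)⟩
  choose γ h0 hγ using hloc
  have hmem : ∀ s : ℝ, ∀ n : ℕ, |s| ≤ n → s ∈ Ioo (-((n : ℝ) + 1)) (n + 1) := fun s n hs => by
    have := abs_le.1 hs
    constructor <;> linarith
  have huniq : ∀ m n : ℕ, m ≤ n → EqOn (γ m) (γ n) (Ioo (-((m : ℝ) + 1)) (m + 1)) :=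
    fun m n hmn => by
      have hmn' : (m : ℝ) ≤ n := by exact_mod_cast hmn
      exact ODE_solution_unique_of_mem_Ioo (v := fun _ => f) (s := fun _ => univ) (K := K)
        (t₀ := 0) (fun _ _ => hf.lipschitzOnWith) (hmem 0 m (by simp))
        (fun s hs => ⟨hγ m s hs, trivial⟩)
        (fun s hs => ⟨hγ n s ⟨by linarith [hs.1], by linarith [hs.2]⟩, trivial⟩)
        ((h0 m).trans (h0 n).symm)
  have heq : ∀ n : ℕ, ∀ s ∈ Ioo (-((n : ℝ) + 1)) (n + 1), γ ⌈|s|⌉₊ s = γ n s := fun n s hs => by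
    rcases le_total ⌈|s|⌉₊ n with h | h
    · exact huniq _ _ h (hmem s _ (Nat.le_ceil _))
    · exact (huniq _ _ h hs).symm
  refine ⟨fun s => γ ⌈|s|⌉₊ s, h0 _, fun s => ?_⟩
  have hs := hmem s ⌈|s|⌉₊ (Nat.le_ceil _)
  exact (hγ _ s hs).congr_of_eventuallyEq (Filter.eventuallyEq_of_mem (Ioo_mem_nhds hs.1 hs.2)
    fun r hr => heq _ r hr)

/-- Truncation of the real line to `[-ρ, ρ]`. -/
def clamp (ρ u : ℝ) : ℝ := max (-ρ) (min ρ u)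

lemma clamp_mem {ρ : ℝ} (hρ : 0 ≤ ρ) (u : ℝ) : clamp ρ u ∈ Icc (-ρ) ρ :=
  ⟨le_max_left _ _, max_le (by linarith) (min_le_left _ _)⟩

lemma clamp_of_abs_le {ρ u : ℝ} (hu : |u| ≤ ρ) : clamp ρ u = u := by
  rw [clamp, min_eq_right (abs_le.1 hu).2, max_eq_right (abs_le.1 hu).1]

lemma lipschitzWith_clamp (ρ : ℝ) : LipschitzWith 1 (clamp ρ) :=
  (LipschitzWith.id.const_min ρ).const_max (-ρ)

namespace IsDuffingForce

variable {g G : ℝ → ℝ} {l ρ K : ℝ} {L : NNReal}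

lemma sq_add_sq_le (hg : IsDuffingForce g G l ρ K L) {a : ℝ} (ha : 3 * a ^ 2 < ρ ^ 2)
    {y p : ℝ → ℝ} (hc : IsHamiltonianCurve id g a y p) (s : ℝ) :
    y s ^ 2 + p s ^ 2 ≤ 3 * a ^ 2 :=
  hc.sq_add_sq_le (K := fun u => u ^ 2 / 2) hg.pos
    (fun u => by simpa using ((hasDerivAt_id u).pow 2).div_const 2) hg.hasDerivAt (by simp) hg.zero
    (fun u _ => by simp; positivity) hg.near_linear ha s

/-- Clamping both components of the field makes it bounded and globally Lipschitz. The energy trap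
also applies to the clamped system, whose orbit therefore never meets the clamp and solves the
original equation. -/
theorem exists_curve (hg : IsDuffingForce g G l ρ K L) {a : ℝ} (ha : 3 * a ^ 2 < ρ ^ 2) :
    ∃ y p : ℝ → ℝ, IsHamiltonianCurve id g a y p := by
  have hρ := hg.pos
  have hcl : ∀ u, clamp ρ u ∈ Icc (-ρ) ρ := clamp_mem hρ.le
  have hgl : LipschitzWith L fun u => g (clamp ρ u) := by
    have := (hg.lipschitz.comp (lipschitzWith_clamp ρ).lipschitzOnWith
      (s := univ) (fun u _ => hcl u))
    rw [mul_one] at this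
    exact lipschitzOnWith_univ.1 this
  have hgb : ∀ u, |g (clamp ρ u)| ≤ 2 * ρ := fun u => by
    have h1 := abs_le.2 (hcl u)
    have h2 := hg.near_linear _ h1
    have h3 := abs_sub_abs_le_abs_sub (g (clamp ρ u)) (clamp ρ u)
    linarith
  obtain ⟨γ, h0, hγ⟩ := exists_hasDerivAt_of_lipschitz_of_bounded
    (f := fun x : ℝ × ℝ => (clamp ρ x.2, -g (clamp ρ x.1))) (K := max (1 * 1) (L * 1))
    (M := (2 * ρ).toNNReal)
    (((lipschitzWith_clamp ρ).comp LipschitzWith.prod_snd).prodMk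
      (hgl.comp LipschitzWith.prod_fst).neg)
    (fun x => by
      rw [Real.coe_toNNReal _ (by positivity), Prod.norm_def]
      refine max_le ?_ (by simpa using hgb x.1)
      have := abs_le.2 (hcl x.2)
      simp only [Real.norm_eq_abs]
      linarith) (0, a)
  have hc : IsHamiltonianCurve (clamp ρ) (fun u => g (clamp ρ u)) a (fun s => (γ s).1)
      (fun s => (γ s).2) :=
    ⟨fun s => (ContinuousLinearMap.fst ℝ ℝ ℝ).hasFDerivAt.comp_hasDerivAt s (hγ s),
      fun s => (ContinuousLinearMap.snd ℝ ℝ ℝ).hasFDerivAt.comp_hasDerivAt s (hγ s),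
      by simp [h0], by simp [h0]⟩
  have hint : ∀ f : ℝ → ℝ, Continuous f → ∀ u,
      HasDerivAt (fun u => ∫ x in (0 : ℝ)..u, f x) (f u) u :=
    fun f hf u => intervalIntegral.integral_hasDerivAt_right (hf.intervalIntegrable _ _)
      hf.stronglyMeasurable.stronglyMeasurableAtFilter hf.continuousAt
  have htrap := hc.sq_add_sq_le hρ (hint _ (lipschitzWith_clamp ρ).continuous)
    (hint _ hgl.continuous) (by simp) (by simp)
    (fun u hu => by rw [clamp_of_abs_le hu]; simp; positivity)
    (fun u hu => by rw [clamp_of_abs_le hu]; exact hg.near_linear u hu) ha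
  refine ⟨fun s => (γ s).1, fun s => (γ s).2, fun s => ?_, fun s => ?_, hc.init_pos, hc.init_vel⟩
  · have h2 : |(γ s).2| ≤ ρ := abs_le_of_sq_le_sq (by nlinarith [htrap s]) hρ.le
    have := hc.deriv_pos s
    rwa [clamp_of_abs_le h2] at this
  · have h1 : |(γ s).1| ≤ ρ := abs_le_of_sq_le_sq (by nlinarith [htrap s]) hρ.le
    have := hc.deriv_vel s
    simp only [clamp_of_abs_le h1] at this
    exact this

/-- Uniqueness among the integral curves confined to the region where the force is controlled. -/
lemma eq_of_eq_at (hg : IsDuffingForce g G l ρ K L) {y₁ p₁ y₂ p₂ : ℝ → ℝ}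
    (hy₁ : ∀ s, HasDerivAt y₁ (p₁ s) s) (hp₁ : ∀ s, HasDerivAt p₁ (-g (y₁ s)) s)
    (hy₂ : ∀ s, HasDerivAt y₂ (p₂ s) s) (hp₂ : ∀ s, HasDerivAt p₂ (-g (y₂ s)) s)
    (hb₁ : ∀ s, |y₁ s| ≤ ρ) (hb₂ : ∀ s, |y₂ s| ≤ ρ) {s₀ : ℝ} (hy : y₁ s₀ = y₂ s₀)
    (hp : p₁ s₀ = p₂ s₀) : y₁ = y₂ := by
  have hl : LipschitzOnWith (max 1 (L * 1)) (fun x : ℝ × ℝ => (x.2, -g x.1))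
      {x | x.1 ∈ Icc (-ρ) ρ} := by
    refine LipschitzOnWith.prodMk LipschitzWith.prod_snd.lipschitzOnWith ?_
    exact ((hg.lipschitz.comp LipschitzWith.prod_fst.lipschitzOnWith (fun x hx => hx))).neg
  have := ODE_solution_unique_univ (v := fun _ x => ((x.2, -g x.1) : ℝ × ℝ))
    (s := fun _ => {x | x.1 ∈ Icc (-ρ) ρ}) (f := fun s => (y₁ s, p₁ s))
    (g := fun s => (y₂ s, p₂ s)) (t₀ := s₀) (fun _ => hl)
    (fun s => ⟨(hy₁ s).prodMk (hp₁ s), abs_le.1 (hb₁ s)⟩)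
    (fun s => ⟨(hy₂ s).prodMk (hp₂ s), abs_le.1 (hb₂ s)⟩) (by simp [hy, hp])
  funext s
  exact congrArg Prod.fst (congrFun this s)

end IsDuffingForce

/-! ### Normal form and averaging -/

open Complex in
/-- The third-order normal form change of variables: derivative of `z + l P(z, z̄)` along the
flow, minus its rotation with the amplitude-dependent frequency. -/
lemma normalForm_identity (y p f l a : ℂ) :
    let z := p + y * I
    let w := p - y * I
    (I * z - f) + l * (1 / 16 * (3 * z ^ 2 * (I * z - f))
        - 3 / 16 * ((I * z - f) * w ^ 2 + z * (2 * w * (-I * w - f)))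
        + 1 / 32 * (3 * w ^ 2 * (-I * w - f)))
      - I * (1 + 3 / 8 * l * a ^ 2) *
        (z + l * (1 / 16 * z ^ 3 - 3 / 16 * (z * w ^ 2) + 1 / 32 * w ^ 3))
    = 3 / 8 * I * l * (y ^ 2 + p ^ 2 - a ^ 2) * z - (f - l * y ^ 3)
      - l * f * (3 / 16 * z ^ 2 - 3 / 16 * w ^ 2 - 3 / 8 * (z * w) + 3 / 32 * w ^ 2)
      - 3 / 8 * I * l ^ 2 * a ^ 2 *
        (1 / 16 * z ^ 3 - 3 / 16 * (z * w ^ 2) + 1 / 32 * w ^ 3) := by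
  intro z w
  have hI2 : I ^ 2 = -1 := I_sq
  have hI3 : I ^ 3 = -I := by rw [pow_succ, hI2]; ring
  have hI4 : I ^ 4 = 1 := by rw [show I ^ 4 = (I ^ 2) ^ 2 by ring, hI2]; ring
  simp only [z, w]
  ring_nf
  simp only [hI2, hI3, hI4]
  ring

lemma norm_cubic_le {z w : ℂ} {r : ℝ} (hz : ‖z‖ ≤ 2 * r) (hw : ‖w‖ ≤ 2 * r) :
    ‖1 / 16 * z ^ 3 - 3 / 16 * (z * w ^ 2) + 1 / 32 * w ^ 3‖ ≤ 4 * r ^ 3 := by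
  have hr : 0 ≤ r := by linarith [norm_nonneg z]
  have h1 : ‖(1 / 16 : ℂ) * z ^ 3‖ ≤ 1 / 16 * (2 * r) ^ 3 := by
    rw [norm_mul, norm_pow]; norm_num; gcongr
  have h2 : ‖(3 / 16 : ℂ) * (z * w ^ 2)‖ ≤ 3 / 16 * (2 * r * (2 * r) ^ 2) := by
    rw [norm_mul, norm_mul, norm_pow]; norm_num; gcongr
  have h3 : ‖(1 / 32 : ℂ) * w ^ 3‖ ≤ 1 / 32 * (2 * r) ^ 3 := by
    rw [norm_mul, norm_pow]; norm_num; gcongr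
  have h4 := norm_add_le (1 / 16 * z ^ 3 - 3 / 16 * (z * w ^ 2)) (1 / 32 * w ^ 3)
  have h5 := norm_sub_le (1 / 16 * z ^ 3) (3 / 16 * (z * w ^ 2))
  have h6 : 0 ≤ r ^ 3 := by positivity
  nlinarith

lemma norm_quadratic_le {z w : ℂ} {r : ℝ} (hz : ‖z‖ ≤ 2 * r) (hw : ‖w‖ ≤ 2 * r) :
    ‖3 / 16 * z ^ 2 - 3 / 16 * w ^ 2 - 3 / 8 * (z * w) + 3 / 32 * w ^ 2‖ ≤ 4 * r ^ 2 := by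
  have hr : 0 ≤ r := by linarith [norm_nonneg z]
  have h1 : ‖(3 / 16 : ℂ) * z ^ 2‖ ≤ 3 / 16 * (2 * r) ^ 2 := by
    rw [norm_mul, norm_pow]; norm_num; gcongr
  have h2 : ‖(3 / 16 : ℂ) * w ^ 2‖ ≤ 3 / 16 * (2 * r) ^ 2 := by
    rw [norm_mul, norm_pow]; norm_num; gcongr
  have h3 : ‖(3 / 8 : ℂ) * (z * w)‖ ≤ 3 / 8 * (2 * r * (2 * r)) := by
    rw [norm_mul, norm_mul]; norm_num; gcongr
  have h4 : ‖(3 / 32 : ℂ) * w ^ 2‖ ≤ 3 / 32 * (2 * r) ^ 2 := by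
    rw [norm_mul, norm_pow]; norm_num; gcongr
  have h5 := norm_add_le (3 / 16 * z ^ 2 - 3 / 16 * w ^ 2 - 3 / 8 * (z * w)) (3 / 32 * w ^ 2)
  have h6 := norm_sub_le (3 / 16 * z ^ 2 - 3 / 16 * w ^ 2) (3 / 8 * (z * w))
  have h7 := norm_sub_le (3 / 16 * z ^ 2) (3 / 16 * w ^ 2)
  have h8 : 0 ≤ r ^ 2 := by positivity
  nlinarith

-- In the rotating frame, `exp(-iΩs) ζ` has derivative of norm at most `C`, so the error grows at
-- most linearly.
open Complex in
lemma norm_sub_exp_mul_le {ζ ζ' : ℝ → ℂ} {Ω C : ℝ} (hd : ∀ s, HasDerivAt ζ (ζ' s) s)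
    (hb : ∀ s, ‖ζ' s - I * Ω * ζ s‖ ≤ C) (s : ℝ) :
    ‖ζ s - exp ((Ω * s : ℝ) * I) * ζ 0‖ ≤ C * |s| := by
  have he : ∀ s : ℝ, HasDerivAt (fun s : ℝ => exp ((-(Ω * s) : ℝ) * I))
      (exp ((-(Ω * s) : ℝ) * I) * (-(I * Ω))) s := fun s => by
    have h1 : HasDerivAt (fun s : ℝ => -(Ω * s)) (-(Ω * 1)) s :=
      ((hasDerivAt_id s).const_mul Ω).neg
    refine (h1.ofReal_comp.mul_const I).cexp.congr_deriv ?_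
    push_cast
    ring
  have h := Convex.norm_image_sub_le_of_norm_hasDerivWithin_le (s := univ) (C := C)
    (f := fun s : ℝ => exp ((-(Ω * s) : ℝ) * I) * ζ s)
    (fun s _ => ((he s).mul (hd s)).hasDerivWithinAt)
    (fun s _ => by
      have : exp ((-(Ω * s) : ℝ) * I) * (-(I * Ω)) * ζ s + exp ((-(Ω * s) : ℝ) * I) * ζ' s
          = exp ((-(Ω * s) : ℝ) * I) * (ζ' s - I * Ω * ζ s) := by ring
      rw [this, norm_mul, norm_exp_ofReal_mul_I, one_mul]
      exact hb s) convex_univ (mem_univ 0) (mem_univ s)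
  have hinv : exp ((Ω * s : ℝ) * I) * exp ((-(Ω * s) : ℝ) * I) = 1 := by
    rw [← exp_add]; simp
  have heq : ζ s - exp ((Ω * s : ℝ) * I) * ζ 0 = exp ((Ω * s : ℝ) * I) *
      (exp ((-(Ω * s) : ℝ) * I) * ζ s - exp ((-(Ω * 0) : ℝ) * I) * ζ 0) := by
    rw [mul_sub, ← mul_assoc, hinv]; simp
  rw [heq, norm_mul, norm_exp_ofReal_mul_I, one_mul]
  simpa using h

namespace IsDuffingForce

variable {g G : ℝ → ℝ} {l ρ K a : ℝ} {L : NNReal} {y p : ℝ → ℝ}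

lemma abs_position_le (hg : IsDuffingForce g G l ρ K L) (ha : 3 * a ^ 2 < ρ ^ 2)
    (hc : IsHamiltonianCurve id g a y p) (s : ℝ) : |y s| ≤ ρ :=
  abs_le_of_sq_le_sq (by nlinarith [hg.sq_add_sq_le ha hc s]) hg.pos.le

/-- By energy conservation the defect is `-2 (G(y) - y²/2)`, which is quartic because `g u - u` is
cubic. This lets the resonant term be treated as a constant frequency shift. -/
lemma abs_sq_add_sq_sub_le (hg : IsDuffingForce g G l ρ K L) (ha : 3 * a ^ 2 < ρ ^ 2)
    (hc : IsHamiltonianCurve id g a y p) (s : ℝ) :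
    |y s ^ 2 + p s ^ 2 - a ^ 2| ≤ 32 * (1 + K) * |a| ^ 4 := by
  have hK := hg.nonneg
  have hE := hc.energy (K := fun u => u ^ 2 / 2) (H := G)
    (fun u => by simpa using ((hasDerivAt_id u).pow 2).div_const 2) hg.hasDerivAt s
  rw [hg.zero] at hE
  have hy : |y s| ≤ 2 * |a| := by
    refine abs_le_of_sq_le_sq ?_ (by positivity)
    rw [mul_pow, sq_abs]
    nlinarith [hg.sq_add_sq_le ha hc s]
  have h := abs_le_mul_pow_succ_of_abs_deriv_le (f := fun u => G u - u ^ 2 / 2)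
    (f' := fun u => g u - u) (M := 1 + K) (k := 3) (ρ := ρ) (by linarith)
    (fun u _ => ((hg.hasDerivAt u).sub (((hasDerivAt_id u).pow 2).div_const 2)).congr_deriv
      (by simp)) (by simp [hg.zero])
    (fun u hu => by
      have h1 := hg.near_cubic u hu
      have h2 : |g u - u| ≤ |g u - u - l * u ^ 3| + |l * u ^ 3| := by
        have := abs_add_le (g u - u - l * u ^ 3) (l * u ^ 3)
        rwa [sub_add_cancel (g u - u)] at this
      rw [abs_mul, hg.abs_sign, abs_pow, one_mul] at h2
      have h3 : |u| ^ 4 ≤ |u| ^ 3 :=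
        pow_le_pow_of_le_one (abs_nonneg _) (hu.trans hg.le_one) (by norm_num)
      nlinarith) (y s) (hg.abs_position_le ha hc s)
  have h4 : |y s| ^ (3 + 1) ≤ (2 * |a|) ^ 4 := by gcongr
  have h5 : |G (y s) - y s ^ 2 / 2| ≤ (1 + K) * (2 * |a|) ^ 4 := h.trans (by gcongr)
  have h6 : y s ^ 2 + p s ^ 2 - a ^ 2 = -2 * (G (y s) - y s ^ 2 / 2) := by linarith
  rw [h6, abs_mul]
  norm_num
  linarith

open Complex in
/-- Averaging: small oscillations are uniformly close to a rotation with frequency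
`1 + 3 l a² / 8`. -/
theorem norm_sub_rotation_le (hg : IsDuffingForce g G l ρ K L) (ha : 3 * a ^ 2 < ρ ^ 2)
    (hc : IsHamiltonianCurve id g a y p) (s : ℝ) :
    ‖((p s : ℂ) + y s * I) - a * exp (((1 + 3 / 8 * l * a ^ 2) * s : ℝ) * I)‖
      ≤ 8 * |a| ^ 3 + (58 + 104 * K) * |a| ^ 4 * |s| := by
  have hK := hg.nonneg
  set r := |a| with hr
  have hr0 : 0 ≤ r := abs_nonneg a
  have hr1 : r ≤ 1 := by
    refine abs_le_of_sq_le_sq ?_ zero_le_one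
    nlinarith [hg.le_one, hg.pos]
  have hl : ‖(l : ℂ)‖ = 1 := by rw [norm_real, Real.norm_eq_abs, hg.abs_sign]
  set Ω : ℝ := 1 + 3 / 8 * l * a ^ 2 with hΩ
  set z : ℝ → ℂ := fun s => p s + y s * I with hz
  set w : ℝ → ℂ := fun s => p s - y s * I with hw
  set F : ℝ → ℝ := fun s => g (y s) - y s with hF
  -- Under the linear flow `z' = i z`, `w' = -i w`, the operator `d/ds - i` multiplies `z³`, `z w²`,
  -- `w³` by `2i`, `-2i`, `-4i`. The coefficients are chosen to cancel these monomials in `-y³`,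
  -- leaving only the resonant `z² w`.
  set P : ℝ → ℂ := fun s => 1 / 16 * z s ^ 3 - 3 / 16 * (z s * w s ^ 2) + 1 / 32 * w s ^ 3 with hP
  have hsq : ∀ s, p s ^ 2 + y s ^ 2 ≤ (2 * r) ^ 2 := fun s => by
    rw [mul_pow, sq_abs]
    nlinarith [hg.sq_add_sq_le ha hc s]
  have hzn : ∀ s, ‖z s‖ ≤ 2 * r := fun s => by
    rw [hz]
    simp only [norm_add_mul_I]
    exact Real.sqrt_le_iff.2 ⟨by positivity, hsq s⟩
  have hwn : ∀ s, ‖w s‖ ≤ 2 * r := fun s => by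
    have : w s = (p s : ℂ) + ((-y s : ℝ) : ℂ) * I := by simp [hw]; ring
    rw [this, norm_add_mul_I]
    exact Real.sqrt_le_iff.2 ⟨by positivity, by nlinarith [hsq s]⟩
  have hPn : ∀ s, ‖P s‖ ≤ 4 * r ^ 3 := fun s => norm_cubic_le (hzn s) (hwn s)
  have hyn : ∀ s, |y s| ≤ 2 * r := fun s =>
    abs_le_of_sq_le_sq (by nlinarith [hsq s]) (by positivity)
  have hR : ∀ s, |F s - l * y s ^ 3| ≤ 16 * K * r ^ 4 := fun s => by
    calc |F s - l * y s ^ 3| ≤ K * |y s| ^ 4 := hg.near_cubic _ (hg.abs_position_le ha hc s)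
      _ ≤ K * (2 * r) ^ 4 := by gcongr; exact hyn s
      _ = 16 * K * r ^ 4 := by ring
  have hFn : ∀ s, |F s| ≤ (8 + 16 * K) * r ^ 3 := fun s => by
    have h1 : |F s| ≤ |F s - l * y s ^ 3| + |l * y s ^ 3| := by
      have := abs_add_le (F s - l * y s ^ 3) (l * y s ^ 3)
      rwa [sub_add_cancel (F s)] at this
    have h2 : |l * y s ^ 3| ≤ (2 * r) ^ 3 := by
      rw [abs_mul, hg.abs_sign, abs_pow, one_mul]
      gcongr
      exact hyn s
    have h3 : r ^ 4 ≤ r ^ 3 := pow_le_pow_of_le_one hr0 hr1 (by norm_num)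
    nlinarith [hR s]
  have hzd : ∀ s, HasDerivAt z (I * z s - F s) s := fun s => by
    refine ((hc.deriv_vel s).ofReal_comp.add
      ((hc.deriv_pos s).ofReal_comp.mul_const I)).congr_deriv ?_
    simp only [hz, hF, id]
    push_cast
    linear_combination (-(y s : ℂ)) * I_sq
  have hwd : ∀ s, HasDerivAt w (-I * w s - F s) s := fun s => by
    refine ((hc.deriv_vel s).ofReal_comp.sub
      ((hc.deriv_pos s).ofReal_comp.mul_const I)).congr_deriv ?_
    simp only [hw, hF, id]
    push_cast
    linear_combination (-(y s : ℂ)) * I_sq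
  set ζ : ℝ → ℂ := fun s => z s + l * P s with hζ
  set ζ' : ℝ → ℂ := fun s => (I * z s - F s) + l * (1 / 16 * (3 * z s ^ 2 * (I * z s - F s))
        - 3 / 16 * ((I * z s - F s) * w s ^ 2 + z s * (2 * w s * (-I * w s - F s)))
        + 1 / 32 * (3 * w s ^ 2 * (-I * w s - F s))) with hζ'
  have hζd : ∀ s, HasDerivAt ζ (ζ' s) s := fun s => by
    refine ((hzd s).add (((((hzd s).pow 3).const_mul (1 / 16)).sub
      (((hzd s).mul ((hwd s).pow 2)).const_mul (3 / 16))).add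
      (((hwd s).pow 3).const_mul (1 / 32)) |>.const_mul (l : ℂ))).congr_deriv ?_
    simp only [hζ']
    simp
  -- The four remainders add up to at most `57.5 + 104 K` times `r⁴`, using `r⁵ ≤ r⁴`.
  have hdiff : ∀ s, ‖ζ' s - I * Ω * ζ s‖ ≤ (58 + 104 * K) * r ^ 4 := fun s => by
    have hid := normalForm_identity (y s) (p s) (F s) l a
    set e : ℝ := y s ^ 2 + p s ^ 2 - a ^ 2 with he
    set d : ℝ := F s - l * y s ^ 3 with hd
    set Q : ℂ := 3 / 16 * z s ^ 2 - 3 / 16 * w s ^ 2 - 3 / 8 * (z s * w s) + 3 / 32 * w s ^ 2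
      with hQ
    have heq : ζ' s - I * Ω * ζ s =
        3 / 8 * I * l * e * z s - d - l * F s * Q - 3 / 8 * I * l ^ 2 * a ^ 2 * P s := by
      simp only [hζ', hζ, hP, hΩ, hz, hw, he, hd, hQ]
      simp only at hid
      push_cast
      linear_combination hid
    have h1 : ‖3 / 8 * I * l * e * z s‖ ≤ 3 / 8 * (32 * (1 + K) * r ^ 4) * (2 * r) := by
      simp only [norm_mul, hl, norm_I, mul_one, norm_real, Real.norm_eq_abs]
      norm_num
      gcongr
      · exact hg.abs_sq_add_sq_sub_le ha hc s
      · exact hzn s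
    have h2 : ‖(d : ℂ)‖ ≤ 16 * K * r ^ 4 := by
      rw [norm_real]
      exact hR s
    have h3 : ‖l * F s * Q‖ ≤ (8 + 16 * K) * r ^ 3 * (4 * r ^ 2) := by
      simp only [norm_mul, hl, one_mul, norm_real, Real.norm_eq_abs]
      exact mul_le_mul (hFn s) (norm_quadratic_le (hzn s) (hwn s)) (norm_nonneg _) (by positivity)
    have h4 : ‖3 / 8 * I * l ^ 2 * a ^ 2 * P s‖ ≤ 3 / 8 * r ^ 2 * (4 * r ^ 3) := by
      simp only [norm_mul, norm_pow, hl, norm_I, mul_one, norm_real, Real.norm_eq_abs]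
      norm_num
      rw [← sq_abs a]
      gcongr
      exact hPn s
    have h5 : r ^ 5 ≤ r ^ 4 := pow_le_pow_of_le_one hr0 hr1 (by norm_num)
    have h6 : K * r ^ 5 ≤ K * r ^ 4 := by gcongr
    rw [heq]
    have h7 := norm_sub_le (3 / 8 * I * l * e * z s - d - l * F s * Q)
      (3 / 8 * I * l ^ 2 * a ^ 2 * P s)
    have h8 := norm_sub_le (3 / 8 * I * l * e * z s - d) (l * F s * Q)
    have h9 := norm_sub_le (3 / 8 * I * l * e * z s) (d : ℂ)
    nlinarith
  have hrot := norm_sub_exp_mul_le hζd hdiff s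
  have hlP : ∀ s, ‖ζ s - z s‖ ≤ 4 * r ^ 3 := fun s => by
    simp only [hζ, add_sub_cancel_left, norm_mul, hl, one_mul]
    exact hPn s
  have hz0 : z 0 = a := by simp [hz, hc.init_pos, hc.init_vel]
  -- Passing between `ζ` and `z` costs `4 r³` at time `s` and again at time `0`, hence `8 |a|³`.
  have h1 : (z s : ℂ) - a * exp ((Ω * s : ℝ) * I) = -(ζ s - z s)
      + (ζ s - exp ((Ω * s : ℝ) * I) * ζ 0) + exp ((Ω * s : ℝ) * I) * (ζ 0 - z 0) := by
    rw [hz0]; ring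
  have h2 : ‖exp ((Ω * s : ℝ) * I) * (ζ 0 - z 0)‖ ≤ 4 * r ^ 3 := by
    rw [norm_mul, norm_exp_ofReal_mul_I, one_mul]
    exact hlP 0
  have h3 := norm_add₃_le (a := -(ζ s - z s)) (b := ζ s - exp ((Ω * s : ℝ) * I) * ζ 0)
    (c := exp ((Ω * s : ℝ) * I) * (ζ 0 - z 0))
  rw [norm_neg] at h3
  rw [h1]
  linarith [hlP s]

lemma abs_sub_sin_le (hg : IsDuffingForce g G l ρ K L) (ha : 3 * a ^ 2 < ρ ^ 2)
    (hc : IsHamiltonianCurve id g a y p) (s : ℝ) :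
    |y s - a * Real.sin ((1 + 3 / 8 * l * a ^ 2) * s)|
      ≤ 8 * |a| ^ 3 + (58 + 104 * K) * |a| ^ 4 * |s| := by
  refine le_trans ?_ (hg.norm_sub_rotation_le ha hc s)
  refine le_trans (le_of_eq ?_) (Complex.abs_im_le_norm _)
  congr 1
  simp [Complex.exp_ofReal_mul_I_im, -Complex.ofReal_mul]

lemma abs_sub_cos_le (hg : IsDuffingForce g G l ρ K L) (ha : 3 * a ^ 2 < ρ ^ 2)
    (hc : IsHamiltonianCurve id g a y p) (s : ℝ) :
    |p s - a * Real.cos ((1 + 3 / 8 * l * a ^ 2) * s)|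
      ≤ 8 * |a| ^ 3 + (58 + 104 * K) * |a| ^ 4 * |s| := by
  refine le_trans ?_ (hg.norm_sub_rotation_le ha hc s)
  refine le_trans (le_of_eq ?_) (Complex.abs_re_le_norm _)
  congr 1
  simp [Complex.exp_ofReal_mul_I_re, -Complex.ofReal_mul]

/-! ### Periodicity -/

/-- Reversibility at a turning point. -/
lemma symm_of_turning_point (hg : IsDuffingForce g G l ρ K L) (ha : 3 * a ^ 2 < ρ ^ 2)
    (hc : IsHamiltonianCurve id g a y p) {c : ℝ} (hp : p c = 0) (s : ℝ) :
    y (2 * c - s) = y s := by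
  have hlin : ∀ s, HasDerivAt (fun s => 2 * c - s) (-1) s := fun s =>
    (hasDerivAt_id s).const_sub (2 * c)
  have h := hg.eq_of_eq_at (y₁ := fun s => y (2 * c - s)) (p₁ := fun s => -p (2 * c - s))
    (y₂ := y) (p₂ := p) (s₀ := c)
    (fun s => ((hc.deriv_pos _).comp s (hlin s)).congr_deriv (by simp))
    (fun s => ((hc.deriv_vel _).comp s (hlin s)).neg.congr_deriv (by simp))
    hc.deriv_pos hc.deriv_vel (fun s => hg.abs_position_le ha hc _) (hg.abs_position_le ha hc)
    (by ring_nf) (by simp only [two_mul, add_sub_cancel_right, hp, neg_zero])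
  exact congrFun h s

/-- The averaged estimate forces the velocity to change sign on `(0, π)` and again on `(π, 2π)`. The
reflections about these two turning points compose to a translation that preserves the orbit. -/
theorem periodic (hg : IsDuffingForce g G l ρ K L) (ha : 3 * a ^ 2 < ρ ^ 2)
    (hsmall : a ^ 2 * (40 + 16 * (58 + 104 * K)) ≤ 1)
    (hc : IsHamiltonianCurve id g a y p) : ∃ T, 0 < T ∧ Function.Periodic y T := by
  have hK := hg.nonneg
  rcases eq_or_ne a 0 with rfl | ha0
  · have hy : ∀ s, y s = 0 := fun s => by
      nlinarith [hg.sq_add_sq_le ha hc s, sq_nonneg (y s), sq_nonneg (p s)]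
    exact ⟨1, one_pos, fun s => by rw [hy, hy]⟩
  have har : 0 < |a| := abs_pos.2 ha0
  have ha2 : |a| ^ 2 = a ^ 2 := sq_abs a
  have hapos : 0 < a ^ 2 := by positivity
  have ha40 : a ^ 2 ≤ 1 / 40 := by nlinarith
  have hl := abs_le.1 hg.abs_sign.le
  have hpi := Real.pi_lt_d2
  have hpi0 := Real.pi_pos
  -- Multiplying by `a` avoids splitting on its sign. The factor `8` bounds `2π`, and `hsmall` is
  -- calibrated to keep the error strictly below `a² / 2`, against the lower bound `1 / 2` on the
  -- cosine in `hcos`.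
  have herr : ∀ s, 0 ≤ s → s ≤ 2 * Real.pi →
      |a * p s - a ^ 2 * Real.cos ((1 + 3 / 8 * l * a ^ 2) * s)| < a ^ 2 / 2 := fun s hs0 hs1 => by
    have h1 := hg.abs_sub_cos_le ha hc s
    rw [abs_of_nonneg hs0] at h1
    have h2 : (58 + 104 * K) * |a| ^ 4 * s ≤ (58 + 104 * K) * |a| ^ 4 * 8 := by
      gcongr
      linarith
    have h3 : a * p s - a ^ 2 * Real.cos ((1 + 3 / 8 * l * a ^ 2) * s)
        = a * (p s - a * Real.cos ((1 + 3 / 8 * l * a ^ 2) * s)) := by ring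
    rw [h3, abs_mul]
    have hpow : |a| ^ 4 ≤ |a| ^ 3 := by
      refine pow_le_pow_of_le_one (abs_nonneg _) ?_ (by norm_num)
      exact abs_le_of_sq_le_sq (by linarith) zero_le_one
    calc |a| * |p s - a * Real.cos ((1 + 3 / 8 * l * a ^ 2) * s)|
        ≤ |a| * (8 * |a| ^ 3 + (58 + 104 * K) * |a| ^ 3 * 8) := by
          gcongr
          refine h1.trans ?_
          nlinarith
      _ = a ^ 2 * (a ^ 2 * (8 + 8 * (58 + 104 * K))) := by rw [← ha2]; ring
      _ < a ^ 2 * (1 / 2) := by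
          gcongr
          nlinarith
      _ = a ^ 2 / 2 := by ring
  have hcos : ∀ s, 0 ≤ s → s ≤ 2 * Real.pi → 1 / 2 ≤ Real.cos (3 / 8 * l * a ^ 2 * s) :=
    fun s hs0 hs1 => by
      refine le_trans ?_ (Real.one_sub_sq_div_two_le_cos)
      have h1 : |3 / 8 * l * a ^ 2 * s| ≤ 1 := by
        rw [abs_mul, abs_mul, abs_mul, hg.abs_sign, abs_of_nonneg hs0, abs_of_pos hapos]
        norm_num
        nlinarith
      have h2 := (sq_le_one_iff_abs_le_one _).2 h1
      linarith
  have hcont : Continuous fun s => a * p s := by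
    have : Continuous p := continuous_iff_continuousAt.2 fun s => (hc.deriv_vel s).continuousAt
    fun_prop
  have hp0 : 0 < a * p 0 := by rw [hc.init_vel, ← sq]; exact hapos
  have hp1 : a * p Real.pi < 0 := by
    have h1 := (abs_lt.1 (herr Real.pi hpi0.le (by linarith))).2
    have h2 := hcos Real.pi hpi0.le (by linarith)
    rw [show (1 + 3 / 8 * l * a ^ 2) * Real.pi = 3 / 8 * l * a ^ 2 * Real.pi + Real.pi by ring,
      Real.cos_add_pi] at h1
    nlinarith
  have hp2 : 0 < a * p (2 * Real.pi) := by
    have h1 := (abs_lt.1 (herr (2 * Real.pi) (by linarith) le_rfl)).1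
    have h2 := hcos (2 * Real.pi) (by linarith) le_rfl
    rw [show (1 + 3 / 8 * l * a ^ 2) * (2 * Real.pi)
      = 3 / 8 * l * a ^ 2 * (2 * Real.pi) + 2 * Real.pi by ring, Real.cos_add_two_pi] at h1
    nlinarith
  obtain ⟨c₁, hc₁, h₁⟩ := intermediate_value_Ioo' hpi0.le hcont.continuousOn ⟨hp1, hp0⟩
  obtain ⟨c₂, hc₂, h₂⟩ := intermediate_value_Ioo (by linarith : Real.pi ≤ 2 * Real.pi)
    hcont.continuousOn ⟨hp1, hp2⟩
  have hz₁ : p c₁ = 0 := (mul_eq_zero.1 h₁).resolve_left ha0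
  have hz₂ : p c₂ = 0 := (mul_eq_zero.1 h₂).resolve_left ha0
  refine ⟨2 * (c₂ - c₁), by linarith [hc₁.2, hc₂.1], fun s => ?_⟩
  rw [show s + 2 * (c₂ - c₁) = 2 * c₂ - (2 * c₁ - s) by ring,
    hg.symm_of_turning_point ha hc hz₂, hg.symm_of_turning_point ha hc hz₁]

end IsDuffingForce

/-! ### The asymptotic trajectory in natural units -/

namespace IsDuffingForce

variable {g G : ℝ → ℝ} {l ρ K : ℝ} {L : NNReal} {y p : ℝ → ℝ}

/-- After about `n` half periods, a small oscillation with amplitude `Γ v` is, up to scaling,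
close to the asymptotic trajectory. -/
lemma abs_rescaled_sub_asymptoticTrajectory_le (hg : IsDuffingForce g G l ρ K L) {Γ v t : ℝ}
    {n : ℕ} (hΓ : 0 < Γ) (hΓt : 3 * Real.pi * n * Γ ^ 2 = 8 * t) (ht : 0 ≤ t) (hv : |v| ≤ 1)
    (hsmall : 3 * Γ ^ 2 < ρ ^ 2) (hc : IsHamiltonianCurve id g (Γ * v) y p) :
    |(-1) ^ n * Γ⁻¹ * y (n * Real.pi - l * t) - asymptoticTrajectory l v t|
      ≤ 8 * Γ ^ 2 + Γ ^ 2 * t + (58 + 104 * K) * Γ ^ 3 * (n * Real.pi + t) := by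
  have hK := hg.nonneg
  have hv2 : v ^ 2 ≤ 1 := (sq_le_one_iff_abs_le_one _).2 hv
  have ha : 3 * (Γ * v) ^ 2 < ρ ^ 2 := by
    rw [mul_pow]
    nlinarith [sq_nonneg Γ]
  have hll : l ^ 2 = 1 := by rw [← sq_abs, hg.abs_sign, one_pow]
  set s := n * Real.pi - l * t with hs
  set B := 3 / 8 * Γ ^ 2 * v ^ 2 * t with hB
  have hsn : |s| ≤ n * Real.pi + t := by
    have h1 := abs_sub (n * Real.pi) (l * t)
    rwa [abs_mul l, hg.abs_sign, one_mul, abs_of_nonneg ht,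
      abs_of_nonneg (by positivity : 0 ≤ n * Real.pi)] at h1
  -- By `hΓt` the frequency shift over `n π` is exactly `l t v²`; `B` is the shift over the
  -- remaining time `l t`.
  have hphase : (1 + 3 / 8 * l * (Γ * v) ^ 2) * s
      = (l * t * (v ^ 2 - 1) - B) + n * Real.pi := by
    rw [hs, hB]
    linear_combination (l * v ^ 2 / 8) * hΓt - (3 / 8 * Γ ^ 2 * v ^ 2 * t) * hll
  have hsin : Real.sin ((1 + 3 / 8 * l * (Γ * v) ^ 2) * s)
      = (-1) ^ n * Real.sin (l * t * (v ^ 2 - 1) - B) := by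
    rw [hphase, Real.sin_add_nat_mul_pi]
  have hsgn : ((-1 : ℝ) ^ n) * (-1) ^ n = 1 := by rw [← mul_pow]; simp
  have hmain := hg.abs_sub_sin_le ha hc s
  rw [hsin] at hmain
  have hav : |Γ * v| ≤ Γ := by
    rw [abs_mul, abs_of_pos hΓ]
    exact mul_le_of_le_one_right hΓ.le hv
  have hbound : |y s - Γ * v * ((-1) ^ n * Real.sin (l * t * (v ^ 2 - 1) - B))|
      ≤ Γ * (8 * Γ ^ 2 + (58 + 104 * K) * Γ ^ 3 * (n * Real.pi + t)) := by
    refine hmain.trans ?_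
    calc 8 * |Γ * v| ^ 3 + (58 + 104 * K) * |Γ * v| ^ 4 * |s|
        ≤ 8 * Γ ^ 3 + (58 + 104 * K) * Γ ^ 4 * (n * Real.pi + t) := by gcongr
      _ = _ := by ring
  have hsplit : (-1) ^ n * Γ⁻¹ * y s - asymptoticTrajectory l v t
      = (-1) ^ n * Γ⁻¹ * (y s - Γ * v * ((-1) ^ n * Real.sin (l * t * (v ^ 2 - 1) - B)))
        + v * (Real.sin (l * t * (v ^ 2 - 1) - B) - Real.sin (l * t * (v ^ 2 - 1))) := by
    rw [asymptoticTrajectory]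
    have : Γ⁻¹ * Γ = 1 := inv_mul_cancel₀ hΓ.ne'
    linear_combination (v * Real.sin (l * t * (v ^ 2 - 1) - B)) * hsgn
      + ((-1) ^ n * (-1) ^ n * v * Real.sin (l * t * (v ^ 2 - 1) - B)) * this
  have h1 : |(-1) ^ n * Γ⁻¹ * (y s - Γ * v * ((-1) ^ n * Real.sin (l * t * (v ^ 2 - 1) - B)))|
      ≤ 8 * Γ ^ 2 + (58 + 104 * K) * Γ ^ 3 * (n * Real.pi + t) := by
    rw [abs_mul, abs_mul, abs_pow, abs_neg, abs_one, one_pow, one_mul, abs_of_pos (inv_pos.2 hΓ)]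
    rw [inv_mul_le_iff₀ hΓ]
    exact hbound
  have h2 : |Real.sin (l * t * (v ^ 2 - 1) - B) - Real.sin (l * t * (v ^ 2 - 1))| ≤ |B| := by
    have := Real.abs_sin_sub_sin_le (l * t * (v ^ 2 - 1) - B) (l * t * (v ^ 2 - 1))
    rwa [sub_sub_cancel_left, abs_neg] at this
  have h3 : |B| ≤ Γ ^ 2 * t := by
    rw [abs_of_nonneg (by positivity), hB]
    have : 0 ≤ Γ ^ 2 * t := by positivity
    nlinarith
  have h4 : |v * (Real.sin (l * t * (v ^ 2 - 1) - B) - Real.sin (l * t * (v ^ 2 - 1)))|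
      ≤ Γ ^ 2 * t := by
    rw [abs_mul]
    exact (mul_le_of_le_one_left (abs_nonneg _) hv).trans (h2.trans h3)
  rw [hsplit]
  linarith [abs_add_le ((-1) ^ n * Γ⁻¹ * (y s - Γ * v * ((-1) ^ n *
    Real.sin (l * t * (v ^ 2 - 1) - B)))) (v * (Real.sin (l * t * (v ^ 2 - 1) - B)
    - Real.sin (l * t * (v ^ 2 - 1))))]

end IsDuffingForce

/-! ### Passage to natural units -/

/-- The restoring force in natural units of length and time. -/
noncomputable def scaledForce (V : ℝ → ℝ) (qs u : ℝ) : ℝ :=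
  deriv V (qs + muScale V qs * u) / (iteratedDeriv 2 V qs * muScale V qs)

/-- The potential in natural units. -/
noncomputable def scaledPotential (V : ℝ → ℝ) (qs u : ℝ) : ℝ :=
  (V (qs + muScale V qs * u) - V qs) / (iteratedDeriv 2 V qs * muScale V qs ^ 2)

namespace IsNonIsochronousAt

variable {V : ℝ → ℝ} {qs m : ℝ}

lemma muScale_pos (hV : IsNonIsochronousAt V qs) : 0 < muScale V qs := by
  have := hV.deriv_two_pos
  have := abs_pos.2 hV.deriv_four_ne_zero
  exact Real.sqrt_pos.2 (by positivity)

lemma omegaScale_pos (hV : IsNonIsochronousAt V qs) (hm : 0 < m) : 0 < omegaScale m V qs :=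
  Real.sqrt_pos.2 (div_pos hV.deriv_two_pos hm)

lemma mul_omegaScale_sq (hV : IsNonIsochronousAt V qs) (hm : 0 < m) :
    m * omegaScale m V qs ^ 2 = iteratedDeriv 2 V qs := by
  rw [omegaScale, Real.sq_sqrt (div_pos hV.deriv_two_pos hm).le]
  field_simp

lemma ellSign_eq (hV : IsNonIsochronousAt V qs) : ellSign V qs = 1 ∨ ellSign V qs = -1 := by
  rcases hV.deriv_four_ne_zero.lt_or_gt with h | h
  · exact Or.inr (Real.sign_of_neg h)
  · exact Or.inl (Real.sign_of_pos h)

lemma iteratedDeriv_four_mul_sq (hV : IsNonIsochronousAt V qs) :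
    iteratedDeriv 4 V qs * muScale V qs ^ 2 = 6 * ellSign V qs * iteratedDeriv 2 V qs := by
  have h2 := hV.deriv_two_pos
  have h4 := hV.deriv_four_ne_zero
  have h4' := abs_pos.2 h4
  rw [muScale, Real.sq_sqrt (by positivity), ellSign]
  rcases h4.lt_or_gt with h | h
  · rw [Real.sign_of_neg h, abs_of_neg h]; field_simp
  · rw [Real.sign_of_pos h, abs_of_pos h]; field_simp

/-- The scaled fifth derivative is bounded on a compact interval. Integrating from `0` four times
yields the quartic remainder of the force; `muScale` is the length that normalizes the cubic
coefficient to `±1`. -/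
theorem exists_isDuffingForce (hV : IsNonIsochronousAt V qs) :
    ∃ ρ K L, IsDuffingForce (scaledForce V qs) (scaledPotential V qs) (ellSign V qs) ρ K L := by
  have hμ := hV.muScale_pos
  have h2 := hV.deriv_two_pos
  have hμ4 := hV.iteratedDeriv_four_mul_sq
  set μ := muScale V qs with hμdef
  set V₂ := iteratedDeriv 2 V qs with hV₂
  set l := ellSign V qs with hl
  have habs : |l| = 1 := by
    rcases hV.ellSign_eq with h | h <;> simp [l, h]
  have hD : ∀ k : ℕ, k < 5 → ∀ u, HasDerivAt (fun u => iteratedDeriv k V (qs + μ * u))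
      (iteratedDeriv (k + 1) V (qs + μ * u) * μ) u := fun k hk u => by
    have h1 : HasDerivAt (iteratedDeriv k V) (iteratedDeriv (k + 1) V (qs + μ * u))
        (qs + μ * u) := by
      rw [iteratedDeriv_succ]
      exact (hV.contDiff.differentiable_iteratedDeriv k (by exact_mod_cast hk) _).hasDerivAt
    have h2 : HasDerivAt (fun u => qs + μ * u) μ u := by
      simpa using ((hasDerivAt_id u).const_mul μ).const_add qs
    exact h1.comp u h2
  obtain ⟨M, hM⟩ : ∃ M, ∀ u ∈ Icc (-1 : ℝ) 1,
      ‖iteratedDeriv 5 V (qs + μ * u) * μ ^ 3 / V₂‖ ≤ M :=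
    isCompact_Icc.exists_bound_of_continuousOn (by
      have := hV.contDiff.continuous_iteratedDeriv 5 le_rfl
      fun_prop)
  have hM0 : 0 ≤ M := (norm_nonneg _).trans (hM 0 (by constructor <;> norm_num))
  have e3 := abs_le_mul_pow_succ_of_abs_deriv_le (ρ := 1) (k := 0) hM0
    (f := fun u => iteratedDeriv 4 V (qs + μ * u) * μ ^ 2 / V₂ - 6 * l)
    (f' := fun u => iteratedDeriv 5 V (qs + μ * u) * μ ^ 3 / V₂)
    (fun u _ => ((((hD 4 (by norm_num) u).mul_const (μ ^ 2)).div_const V₂).sub_const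
      (6 * l)).congr_deriv (by ring))
    (by simp only [mul_zero, add_zero, hμ4]; field_simp; ring)
    (fun u hu => by
      rw [pow_zero, mul_one]
      exact hM u (abs_le.1 hu))
  have e2 := abs_le_mul_pow_succ_of_abs_deriv_le (ρ := 1) hM0
    (f := fun u => iteratedDeriv 3 V (qs + μ * u) * μ / V₂ - 6 * l * u)
    (fun u _ => ((((hD 3 (by norm_num) u).mul_const μ).div_const V₂).sub
      ((hasDerivAt_id u).const_mul (6 * l))).congr_deriv (by ring))
    (by simp [hV.deriv_three_eq_zero]) e3
  have e1 := abs_le_mul_pow_succ_of_abs_deriv_le (ρ := 1) hM0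
    (f := fun u => iteratedDeriv 2 V (qs + μ * u) / V₂ - 1 - 3 * l * u ^ 2)
    (fun u _ => ((((hD 2 (by norm_num) u).div_const V₂).sub_const 1).sub
      (((hasDerivAt_id u).pow 2).const_mul (3 * l))).congr_deriv (by simp; ring))
    (by simp [← hV₂, h2.ne']) e2
  have hgd : ∀ u, HasDerivAt (scaledForce V qs) (iteratedDeriv 2 V (qs + μ * u) / V₂) u :=
    fun u => by
      have h := (hD 1 (by norm_num) u).div_const (V₂ * μ)
      rw [iteratedDeriv_one] at h
      refine h.congr_deriv ?_
      field_simp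
  have e0 := abs_le_mul_pow_succ_of_abs_deriv_le (ρ := 1) hM0
    (f := fun u => scaledForce V qs u - u - l * u ^ 3)
    (fun u _ => (((hgd u).sub (hasDerivAt_id u)).sub
      (((hasDerivAt_id u).pow 3).const_mul l)).congr_deriv (by simp; ring))
    (by simp [scaledForce, hV.deriv_eq_zero]) e1
  -- This radius gives `(1 + M) ρ² ≤ 1/4`, which is what the bound `|g u - u| ≤ |u| / 4` needs.
  have hρ0 : 0 < 1 / (2 * (1 + M)) := by positivity
  have hρ1 : 1 / (2 * (1 + M)) ≤ 1 := by
    rw [div_le_one (by positivity)]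
    linarith
  refine ⟨1 / (2 * (1 + M)), M, (M + 4).toNNReal, hρ0, hρ1, hM0, habs, fun u => ?_, ?_, ?_,
    fun u hu => ?_, fun u hu => e0 u (hu.trans hρ1)⟩
  · have h := ((hD 0 (by norm_num) u).sub_const (V qs)).div_const (V₂ * μ ^ 2)
    simp only [iteratedDeriv_zero, zero_add, iteratedDeriv_one] at h
    refine h.congr_deriv ?_
    rw [scaledForce, ← hμdef, ← hV₂]
    field_simp
  · simp [scaledPotential]
  · refine Convex.lipschitzOnWith_of_nnnorm_hasDerivWithin_le (convex_Icc _ _)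
      (fun u _ => (hgd u).hasDerivWithinAt) (fun u hu => ?_)
    have hu1 : |u| ≤ 1 := (abs_le.2 hu).trans hρ1
    rw [← NNReal.coe_le_coe, coe_nnnorm, Real.coe_toNNReal _ (by positivity), Real.norm_eq_abs]
    have h1 := e1 u hu1
    have h3 : M * |u| ^ (0 + 1 + 1 + 1) ≤ M :=
      mul_le_of_le_one_right hM0 (pow_le_one₀ (abs_nonneg _) hu1)
    have h4 : |3 * l * u ^ 2| ≤ 3 := by
      rw [abs_mul, abs_mul, habs, abs_pow]
      norm_num
      exact hu1
    have h5 := abs_le.1 h4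
    have h6 := abs_le.1 (h1.trans h3)
    exact abs_le.2 ⟨by linarith, by linarith⟩
  · have h0 := e0 u (hu.trans hρ1)
    have h1 : |scaledForce V qs u - u| ≤ |scaledForce V qs u - u - l * u ^ 3| + |l * u ^ 3| := by
      have := abs_add_le (scaledForce V qs u - u - l * u ^ 3) (l * u ^ 3)
      rwa [sub_add_cancel (scaledForce V qs u - u)] at this
    rw [abs_mul, habs, abs_pow, one_mul] at h1
    have h3 : |u| ^ (0 + 1 + 1 + 1 + 1) ≤ |u| ^ 3 :=
      pow_le_pow_of_le_one (abs_nonneg _) (hu.trans hρ1) (by norm_num)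
    have h4 : (1 + M) * |u| ^ 2 ≤ 1 / 4 := by
      calc (1 + M) * |u| ^ 2 ≤ (1 + M) * (1 / (2 * (1 + M))) ^ 2 := by gcongr
        _ = 1 / 4 * (1 / (1 + M)) := by field_simp; norm_num
        _ ≤ 1 / 4 * 1 := by
          gcongr
          rw [div_le_one (by positivity)]
          linarith
        _ = 1 / 4 := by norm_num
    calc |scaledForce V qs u - u| ≤ M * |u| ^ 3 + |u| ^ 3 := by
          refine h1.trans ?_
          gcongr
          exact h0.trans (by gcongr)
      _ = |u| * ((1 + M) * |u| ^ 2) := by ring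
      _ ≤ |u| * (1 / 4) := by gcongr
      _ = |u| / 4 := by ring

lemma hamiltonianCurve_of_isELSolution (hV : IsNonIsochronousAt V qs) (hm : 0 < m) {ν : ℝ}
    {y : ℝ → ℝ} (hy : IsELSolution m V qs ν y) :
    IsHamiltonianCurve id (scaledForce V qs) (ν / (muScale V qs * omegaScale m V qs))
      (fun s => (y (s / omegaScale m V qs) - qs) / muScale V qs)
      (fun s => deriv y (s / omegaScale m V qs) / (muScale V qs * omegaScale m V qs)) := by
  have hμ := hV.muScale_pos
  have hω := hV.omegaScale_pos hm
  have hmω := hV.mul_omegaScale_sq hm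
  set μ := muScale V qs with hμdef
  set ω := omegaScale m V qs
  have hs : ∀ s, HasDerivAt (fun s : ℝ => s / ω) (1 / ω) s := fun s =>
    (hasDerivAt_id s).div_const ω
  refine ⟨fun s => ?_, fun s => ?_, by simp [hy.init_pos], by simp [hy.init_vel]⟩
  · refine ((((hy.differentiable _).hasDerivAt.comp s (hs s)).sub_const qs).div_const
      μ).congr_deriv ?_
    simp only [id]
    field_simp
  · refine (((hy.differentiable_deriv _).hasDerivAt.comp s (hs s)).div_const
      (μ * ω)).congr_deriv ?_
    have h := hy.eulerLagrange (s / ω)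
    have hq : qs + μ * ((y (s / ω) - qs) / μ) = y (s / ω) := by field_simp; ring
    rw [scaledForce, ← hμdef, hq, ← hmω]
    field_simp
    linarith

lemma isELSolution_of_hamiltonianCurve (hV : IsNonIsochronousAt V qs) (hm : 0 < m) {a : ℝ}
    {u p : ℝ → ℝ} (hc : IsHamiltonianCurve id (scaledForce V qs) a u p) :
    IsELSolution m V qs (a * (muScale V qs * omegaScale m V qs))
      (fun τ => qs + muScale V qs * u (omegaScale m V qs * τ)) := by
  have hμ := hV.muScale_pos
  have hmω := hV.mul_omegaScale_sq hm
  have h2 := hV.deriv_two_pos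
  set μ := muScale V qs with hμdef
  set ω := omegaScale m V qs
  have hs : ∀ s, HasDerivAt (fun s : ℝ => ω * s) ω s := fun s => by
    simpa using (hasDerivAt_id s).const_mul ω
  have hd : ∀ τ, HasDerivAt (fun τ => qs + μ * u (ω * τ)) (p (ω * τ) * (μ * ω)) τ := fun τ =>
    ((((hc.deriv_pos _).comp τ (hs τ)).const_mul μ).const_add qs).congr_deriv (by
      simp only [id]; ring)
  have hd1 : deriv (fun τ => qs + μ * u (ω * τ)) = fun τ => p (ω * τ) * (μ * ω) :=
    funext fun τ => (hd τ).deriv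
  have hd2 : ∀ τ, HasDerivAt (fun τ => p (ω * τ) * (μ * ω))
      (-scaledForce V qs (u (ω * τ)) * ω * (μ * ω)) τ := fun τ =>
    ((hc.deriv_vel _).comp τ (hs τ)).mul_const _
  refine ⟨fun τ => (hd τ).differentiableAt, ?_, fun τ => ?_, by simp [hc.init_pos], ?_⟩
  · rw [hd1]
    exact fun τ => (hd2 τ).differentiableAt
  · rw [hd1, (hd2 τ).deriv, scaledForce, ← hμdef, ← hmω]
    rw [← hmω] at h2
    have hω : ω ≠ 0 := fun h => by simp [h] at h2
    field_simp
  · rw [hd1]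
    simp [hc.init_vel]

theorem exists_unique_periodic (hV : IsNonIsochronousAt V qs) (hm : 0 < m) :
    ∃ ε : ℝ, 0 < ε ∧ ∀ ν ∈ Icc (-ε) ε, (∃! y : ℝ → ℝ, IsELSolution m V qs ν y) ∧
      ∀ y : ℝ → ℝ, IsELSolution m V qs ν y → ∃ T : ℝ, 0 < T ∧ Function.Periodic y T := by
  obtain ⟨ρ, K, L, hg⟩ := hV.exists_isDuffingForce
  have hμ := hV.muScale_pos
  have hω := hV.omegaScale_pos hm
  have hK := hg.nonneg
  have hρ := hg.pos
  set μ := muScale V qs with hμdef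
  set ω := omegaScale m V qs with hωdef
  -- `ρ / D` meets both the trapping and the periodicity smallness conditions, since `D ≥ 4` and `ρ
  -- ≤ 1`.
  obtain ⟨a₀, ha₀, ha₁, ha₂⟩ : ∃ a₀ : ℝ, 0 < a₀ ∧ 3 * a₀ ^ 2 < ρ ^ 2 ∧
      a₀ ^ 2 * (40 + 16 * (58 + 104 * K)) ≤ 1 := by
    set D := 40 + 16 * (58 + 104 * K) with hD
    have hD1 : 4 ≤ D := by linarith
    refine ⟨ρ / D, by positivity, ?_, ?_⟩
    · rw [div_pow, mul_div_assoc', div_lt_iff₀ (by positivity)]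
      have h1 : 0 < ρ ^ 2 := by positivity
      have h2 : 3 < D ^ 2 := by nlinarith
      nlinarith
    · rw [div_pow, div_mul_eq_mul_div, div_le_one (by positivity)]
      have h1 : ρ ^ 2 ≤ 1 := pow_le_one₀ hρ.le hg.le_one
      nlinarith
  refine ⟨a₀ * (μ * ω), by positivity, fun ν hν => ?_⟩
  have hsq : (ν / (μ * ω)) ^ 2 ≤ a₀ ^ 2 := by
    rw [div_pow, div_le_iff₀ (by positivity), ← mul_pow]
    exact sq_le_sq' hν.1 hν.2
  have ha : 3 * (ν / (μ * ω)) ^ 2 < ρ ^ 2 := by linarith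
  have hb : (ν / (μ * ω)) ^ 2 * (40 + 16 * (58 + 104 * K)) ≤ 1 :=
    le_trans (by gcongr) ha₂
  have hback : ∀ (y : ℝ → ℝ) (τ : ℝ), y τ = qs + μ * ((y (ω * τ / ω) - qs) / μ) := fun y τ => by
    rw [mul_div_cancel_left₀ _ hω.ne']
    field_simp
    ring
  refine ⟨?_, fun y hy => ?_⟩
  · obtain ⟨u, p, hc⟩ := hg.exists_curve ha
    have hsol := hV.isELSolution_of_hamiltonianCurve hm hc
    rw [div_mul_cancel₀ _ (by positivity)] at hsol
    refine ⟨_, hsol, fun y hy => ?_⟩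
    have hcy := hV.hamiltonianCurve_of_isELSolution hm hy
    have heq := hg.eq_of_eq_at hcy.deriv_pos hcy.deriv_vel hc.deriv_pos hc.deriv_vel
      (hg.abs_position_le ha hcy) (hg.abs_position_le ha hc)
      (hcy.init_pos.trans hc.init_pos.symm) (hcy.init_vel.trans hc.init_vel.symm)
    funext τ
    rw [hback y τ, ← congrFun heq]
  · have hcy := hV.hamiltonianCurve_of_isELSolution hm hy
    obtain ⟨T, hT, hper⟩ := hg.periodic ha hb hcy
    refine ⟨T / ω, by positivity, fun τ => ?_⟩
    rw [hback y (τ + T / ω), hback y τ]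
    have := hper (ω * τ)
    simp only at this
    rw [show ω * (τ + T / ω) = ω * τ + T by field_simp, this]

end IsNonIsochronousAt

/-! ### Independence of the sign, and convergence with rate -/

lemma asymptoticFocalSet_neg_one (i : ℕ∞) : asymptoticFocalSet (-1) i = asymptoticFocalSet 1 i := by
  ext ⟨t, x⟩
  have h : {v : ℝ | v ∈ Icc (-1) 1 ∧ asymptoticTrajectory (-1) v t = x}
      = Neg.neg '' {v : ℝ | v ∈ Icc (-1) 1 ∧ asymptoticTrajectory 1 v t = x} := by
    ext v
    simp only [image_neg_eq_neg, mem_neg, mem_ofPred_eq, mem_Icc, asymptoticTrajectory]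
    have : -v * Real.sin (1 * t * ((-v) ^ 2 - 1)) = v * Real.sin (-1 * t * (v ^ 2 - 1)) := by
      rw [show -1 * t * (v ^ 2 - 1) = -(1 * t * ((-v) ^ 2 - 1)) by ring, Real.sin_neg]
      ring
    rw [this]
    constructor
    · rintro ⟨⟨h1, h2⟩, h3⟩
      exact ⟨⟨by linarith, by linarith⟩, h3⟩
    · rintro ⟨⟨h1, h2⟩, h3⟩
      exact ⟨⟨by linarith, by linarith⟩, h3⟩
  simp only [asymptoticFocalSet, mem_ofPred_eq, h, neg_injective.encard_image]

lemma scalingParam_sq {n : ℕ} {t : ℝ} (ht : 0 ≤ t) :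
    scalingParam n t ^ 2 = 8 * t / (3 * Real.pi * n) :=
  Real.sq_sqrt (by positivity)

lemma scalingParam_nonneg (n : ℕ) (t : ℝ) : 0 ≤ scalingParam n t := Real.sqrt_nonneg _

lemma scalingParam_sq_le {n : ℕ} (hn : 1 ≤ n) {t d b : ℝ} (ht : 0 ≤ t)
    (h : t ≤ 3 * Real.pi / 8 * d ^ 2 * (n : ℝ) ^ b) :
    scalingParam n t ^ 2 ≤ d ^ 2 * (n : ℝ) ^ (b - 1) := by
  have hn0 : (0 : ℝ) < n := by exact_mod_cast hn
  rw [scalingParam_sq ht, div_le_iff₀ (by positivity), Real.rpow_sub_one hn0.ne']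
  field_simp
  field_simp at h
  linarith

namespace IsNonIsochronousAt

variable {V : ℝ → ℝ} {qs m : ℝ}

/-- Here `d` is the velocity bound in natural units, and `3π d² / 8` is the constant for which `t ≤
(3π d² / 8) n` gives `Γ ≤ d`. -/
theorem renormTrajectory_sub_le (hV : IsNonIsochronousAt V qs) (hm : 0 < m) {d : ℝ} (hd : 0 < d)
    {q : ℝ → ℝ → ℝ}
    (hq : ∀ ν ∈ Icc (-(d * (muScale V qs * omegaScale m V qs)))
      (d * (muScale V qs * omegaScale m V qs)), IsELSolution m V qs ν (q ν))
    {δ : ℝ} (hδ : 0 < δ) (hδ' : δ < 1 / 3) :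
    ∃ C : ℝ, 0 < C ∧ ∃ N : ℕ, 1 ≤ N ∧ ∀ n : ℕ, N ≤ n → ∀ v ∈ Icc (-1 : ℝ) 1,
      ∀ t ∈ Icc 0 (3 * Real.pi / 8 * d ^ 2 * (n : ℝ) ^ (1 / 3 - δ)),
        |renormTrajectory m V qs q n v t - asymptoticTrajectory (ellSign V qs) v t|
          ≤ C * (n : ℝ) ^ (-(3 * δ / 2)) := by
  obtain ⟨ρ, K, L, hg⟩ := hV.exists_isDuffingForce
  have hμ := hV.muScale_pos
  have hω := hV.omegaScale_pos hm
  have hK := hg.nonneg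
  have hρ := hg.pos
  have hpi := Real.pi_pos
  set α := 3 * Real.pi / 8 * d ^ 2 with hα
  have hα0 : 0 < α := by positivity
  -- Beyond `N₀` the amplitude `Γ` is small enough for the energy trap.
  obtain ⟨N₀, hN₀⟩ : ∃ N₀ : ℕ, ∀ n : ℕ, N₀ ≤ n →
      3 * (d ^ 2 * (n : ℝ) ^ (1 / 3 - δ - 1)) < ρ ^ 2 := by
    have h1 : Filter.Tendsto (fun n : ℕ => 3 * (d ^ 2 * (n : ℝ) ^ (-(2 / 3 + δ))))
        Filter.atTop (nhds (3 * (d ^ 2 * 0))) :=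
      (((tendsto_rpow_neg_atTop (by linarith)).comp tendsto_natCast_atTop_atTop).const_mul
        _).const_mul _
    rw [mul_zero, mul_zero] at h1
    have h2 := h1.eventually (gt_mem_nhds (pow_pos hρ 2))
    obtain ⟨N₀, h⟩ := Filter.eventually_atTop.1 h2
    refine ⟨N₀, fun n hn => ?_⟩
    rw [show 1 / 3 - δ - 1 = -(2 / 3 + δ) by ring]
    exact h n hn
  refine ⟨8 * d ^ 2 + d ^ 2 * α + (58 + 104 * K) * d ^ 3 * (Real.pi + α), by positivity,
    max 1 N₀, le_max_left _ _, fun n hn v hv t ht => ?_⟩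
  have hn1 : 1 ≤ n := (le_max_left _ _).trans hn
  have hn1' : (1 : ℝ) ≤ n := by exact_mod_cast hn1
  have hn0 : (0 : ℝ) < n := by linarith
  have hnN := hN₀ n ((le_max_right _ _).trans hn)
  set X := (n : ℝ) ^ (-(3 * δ / 2)) with hX
  have hX0 : 0 < X := by positivity
  -- At `t = 0` the convention `0⁻¹ = 0` makes the renormalized trajectory vanish, as does the
  -- asymptotic one.
  rcases ht.1.eq_or_lt with h0 | h0
  · have h1 : renormTrajectory m V qs q n v t = 0 := by
      simp [renormTrajectory, scalingParam, ← h0]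
    rw [h1]
    simp only [asymptoticTrajectory, ← h0]
    simp
    positivity
  set Γ := scalingParam n t with hΓ
  have hΓsq : Γ ^ 2 = 8 * t / (3 * Real.pi * n) := scalingParam_sq h0.le
  have hΓ0 : 0 < Γ := Real.sqrt_pos.2 (by positivity)
  have hΓle : Γ ^ 2 ≤ d ^ 2 * (n : ℝ) ^ (1 / 3 - δ - 1) := scalingParam_sq_le hn1 h0.le ht.2
  have hrpow : ∀ {b c : ℝ}, b ≤ c → (n : ℝ) ^ b ≤ (n : ℝ) ^ c := fun h =>
    Real.rpow_le_rpow_of_exponent_le hn1' h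
  have hΓd : Γ ≤ d := by
    refine le_of_sq_le_sq ?_ hd.le
    refine hΓle.trans (mul_le_of_le_one_right (by positivity) ?_)
    exact Real.rpow_le_one_of_one_le_of_nonpos hn1' (by linarith)
  have hν : Γ * muScale V qs * omegaScale m V qs * v ∈
      Icc (-(d * (muScale V qs * omegaScale m V qs))) (d * (muScale V qs * omegaScale m V qs)) := by
    refine abs_le.1 ?_
    have hv' := abs_le.2 hv
    rw [mul_assoc Γ, abs_mul, abs_of_pos (by positivity)]
    calc _ ≤ d * (muScale V qs * omegaScale m V qs) * 1 := by gcongr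
      _ = _ := mul_one _
  have hc := hV.hamiltonianCurve_of_isELSolution hm (hq _ hν)
  rw [show Γ * muScale V qs * omegaScale m V qs * v / (muScale V qs * omegaScale m V qs) = Γ * v by
    field_simp] at hc
  have hmain := hg.abs_rescaled_sub_asymptoticTrajectory_le (n := n) (t := t) hΓ0
    (by rw [hΓsq]; field_simp) h0.le (abs_le.2 hv) (by linarith) hc
  have hren : renormTrajectory m V qs q n v t = (-1) ^ n * Γ⁻¹ *
      ((q (Γ * muScale V qs * omegaScale m V qs * v)
        ((n * Real.pi - ellSign V qs * t) / omegaScale m V qs) - qs) / muScale V qs) := by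
    rw [renormTrajectory, ← hΓ]
    ring
  rw [hren]
  refine hmain.trans ?_
  have hΓX : Γ ^ 2 ≤ d ^ 2 * X := hΓle.trans (by gcongr; exact hrpow (by linarith))
  have hΓt : Γ ^ 2 * t ≤ d ^ 2 * α * X := by
    calc Γ ^ 2 * t ≤ d ^ 2 * (n : ℝ) ^ (1 / 3 - δ - 1) * (α * (n : ℝ) ^ (1 / 3 - δ)) :=
          mul_le_mul hΓle ht.2 h0.le (by positivity)
      _ = d ^ 2 * α * (n : ℝ) ^ ((1 / 3 - δ - 1) + (1 / 3 - δ)) := by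
          rw [Real.rpow_add hn0]; ring
      _ ≤ d ^ 2 * α * X := by
          gcongr
          exact hrpow (by linarith)
  have hΓlin : Γ ≤ d * (n : ℝ) ^ (-(1 / 3 + δ / 2)) := by
    refine le_of_sq_le_sq ?_ (by positivity)
    rw [mul_pow, ← Real.rpow_natCast ((n : ℝ) ^ _), ← Real.rpow_mul hn0.le]
    refine hΓle.trans (le_of_eq ?_)
    congr 2
    push_cast
    ring
  have htn : t ≤ α * n := by
    refine ht.2.trans ?_
    gcongr
    calc (n : ℝ) ^ (1 / 3 - δ) ≤ (n : ℝ) ^ (1 : ℝ) := hrpow (by linarith)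
      _ = n := Real.rpow_one _
  -- The critical term: `-3 (1/3 + δ/2) + 1 = -3δ/2`, with no room to spare.
  have hΓn : Γ ^ 3 * n ≤ d ^ 3 * X := by
    calc Γ ^ 3 * n ≤ (d * (n : ℝ) ^ (-(1 / 3 + δ / 2))) ^ 3 * (n : ℝ) ^ (1 : ℝ) := by
          rw [Real.rpow_one]
          gcongr
      _ = d ^ 3 * X := by
          rw [mul_pow, ← Real.rpow_natCast ((n : ℝ) ^ _), ← Real.rpow_mul hn0.le, mul_assoc,
            ← Real.rpow_add hn0, hX]
          congr 2
          push_cast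
          ring
  calc 8 * Γ ^ 2 + Γ ^ 2 * t + (58 + 104 * K) * Γ ^ 3 * (n * Real.pi + t)
      ≤ 8 * Γ ^ 2 + Γ ^ 2 * t + (58 + 104 * K) * Γ ^ 3 * (n * Real.pi + α * n) := by gcongr
    _ = 8 * Γ ^ 2 + Γ ^ 2 * t + (58 + 104 * K) * (Real.pi + α) * (Γ ^ 3 * n) := by ring
    _ ≤ 8 * (d ^ 2 * X) + d ^ 2 * α * X + (58 + 104 * K) * (Real.pi + α) * (d ^ 3 * X) := by
        gcongr
    _ = _ := by ring

end IsNonIsochronousAt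

end

theorem mainTheorem2 :
    ∃ σ : ℕ∞ → Set (ℝ × ℝ),
      -- `σ` is a decomposition of the half-cylinder
      (⋃ i, σ i) = halfCylinder ∧
      Pairwise (fun i j => Disjoint (σ i) (σ j)) ∧
      -- the same `σ` serves every system of the class
      ∀ (m : ℝ) (V : ℝ → ℝ) (qs : ℝ), 0 < m → IsNonIsochronousAt V qs →
        -- it is induced by the asymptotic trajectories of the system
        (∀ i, σ i = asymptoticFocalSet (ellSign V qs) i) ∧
        -- the trajectories are well defined and periodic for small initial velocities
        (∃ ε : ℝ, 0 < ε ∧ ∀ ν ∈ Set.Icc (-ε) ε,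
          (∃! y : ℝ → ℝ, IsELSolution m V qs ν y) ∧
          ∀ y : ℝ → ℝ, IsELSolution m V qs ν y → ∃ T : ℝ, 0 < T ∧ Function.Periodic y T) ∧
        -- the renormalized trajectories are well defined and converge
        ∀ ε : ℝ, 0 < ε → ∀ q : ℝ → ℝ → ℝ,
          (∀ ν ∈ Set.Icc (-ε) ε, IsELSolution m V qs ν (q ν)) →
          ∃ α : ℝ, 0 < α ∧ ∃ N : ℕ, 1 ≤ N ∧
            (∀ n : ℕ, N ≤ n → ∀ v ∈ Set.Icc (-1 : ℝ) 1, ∀ t ∈ Set.Icc 0 (α * n),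
              scalingParam n t * muScale V qs * omegaScale m V qs * v ∈ Set.Icc (-ε) ε) ∧
            ∃ β : ℝ, 0 < β ∧ ∀ δ : ℝ, 0 < δ → δ < 1 / 3 →
              ∃ C : ℝ, 0 < C ∧ ∃ N' : ℕ, N ≤ N' ∧ ∀ n : ℕ, N' ≤ n →
                β * (n : ℝ) ^ (1 / 3 - δ) ≤ α * n ∧
                ∀ v ∈ Set.Icc (-1 : ℝ) 1, ∀ t ∈ Set.Icc 0 (β * (n : ℝ) ^ (1 / 3 - δ)),
                  |renormTrajectory m V qs q n v t
                      - asymptoticTrajectory (ellSign V qs) v t|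
                    ≤ C * (n : ℝ) ^ (-(3 * δ / 2)) := by
  refine ⟨asymptoticFocalSet 1, ?_, fun i j hij => ?_, fun m V qs hm hV => ⟨fun i => ?_,
    hV.exists_unique_periodic hm, fun ε hε q hq => ?_⟩⟩
  · ext p
    simp [asymptoticFocalSet]
  · exact Set.disjoint_left.2 fun p hi hj => hij (hi.2.symm.trans hj.2)
  · rcases hV.ellSign_eq with h | h
    · rw [h]
    · rw [h, asymptoticFocalSet_neg_one]
  have hμ := hV.muScale_pos
  have hω := hV.omegaScale_pos hm
  have hpi := Real.pi_pos
  -- One constant `3π d² / 8` serves as both `α` and `β`, and no lower bound on `n` beyond `1` is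
  -- needed for the domain.
  obtain ⟨d, hd, hdε⟩ : ∃ d : ℝ, 0 < d ∧ d * (muScale V qs * omegaScale m V qs) = ε :=
    ⟨ε / (muScale V qs * omegaScale m V qs), by positivity, div_mul_cancel₀ _ (by positivity)⟩
  have hα : 0 < 3 * Real.pi / 8 * d ^ 2 := by positivity
  refine ⟨3 * Real.pi / 8 * d ^ 2, hα, 1, le_rfl, fun n hn v hv t ht => ?_,
    3 * Real.pi / 8 * d ^ 2, hα, fun δ hδ hδ' => ?_⟩
  · have h1 : scalingParam n t ^ 2 ≤ d ^ 2 := by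
      have := scalingParam_sq_le hn (b := 1) (d := d) ht.1 (by rw [Real.rpow_one]; exact ht.2)
      simpa using this
    have h2 : scalingParam n t ≤ d := le_of_sq_le_sq h1 hd.le
    refine abs_le.1 ?_
    rw [mul_assoc (scalingParam n t), abs_mul,
      abs_of_nonneg (mul_nonneg (scalingParam_nonneg n t) (by positivity)), ← hdε]
    calc _ ≤ d * (muScale V qs * omegaScale m V qs) * 1 := by
          gcongr
          exact abs_le.2 hv
      _ = _ := mul_one _
  · rw [← hdε] at hq
    obtain ⟨C, hC, N, hN, h⟩ := hV.renormTrajectory_sub_le hm hd hq hδ hδ'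
    refine ⟨C, hC, N, hN, fun n hn => ⟨?_, h n hn⟩⟩
    have hn1 : (1 : ℝ) ≤ n := by exact_mod_cast hN.trans hn
    gcongr
    calc (n : ℝ) ^ (1 / 3 - δ) ≤ (n : ℝ) ^ (1 : ℝ) :=
          Real.rpow_le_rpow_of_exponent_le hn1 (by linarith)
      _ = n := Real.rpow_one _
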